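/- Let $k$ be a field of characteristic zero, let $K=k(z)$ with the automorphism $\sigma(h(z))=h(z+1)$, let $n\ge 1$, and let $$E=\sigma^n(y)+h_{n-1}\sigma^{n-1}(y)+\cdots+h_0y=0$$ be a linear difference equation with $h_0,\dots,h_{n-1}\in K$ and $h_0\neq 0$. Let $A=A(E)\in\mathrm{GL}_n(K)$ be its companion matrix (ones on the superdiagonal, last row $(-h_0,-h_1,\dots,-h_{n-1})$, zeros elsewhere). *Conventions.* $\mathbb N=\{0,1,2,\dots\}$. An arithmetic progression is a set $j+\mathbb N l\subset\mathbb N$ with $j,l\in\mathbb N$ ($l=0$ is allowed, so singletons count); a finite union may be empty. A solution of $E$ in $k^{\mathbb N}$ is a map $f\colon\mathbb N\to k$ with $f(i+n)+h_{n-1}(i)f(i+n-1)+\cdots+h_0(i)f(i)=0$ for all sufficiently large $i$. Let $X=\mathbb A^1_k\times\mathrm{GL}_{n,k}$ and let $\sigma\colon X\dashrightarrow X$ be the rational map $\sigma(b,B)=(b+1,A(b)B)$. Let $U\subset X$ be the largest open subset on which it is defined; the orbit of $x$ is *defined* if $x,\sigma(x),\sigma^2(x),\dots$ all lie in $U$.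 Let $\mathrm{Seq}_k$ be the ring of sequences $\mathbb N\to k$ with componentwise operations, two sequences being identified if they agree at all sufficiently large indices. It has the shift $\sigma(f)=(f(1),f(2),\dots)$ and is a $K$-algebra, compatibly with $\sigma$, through $h\mapsto(h(0),h(1),\dots)$. A commutative ring $L$ with an endomorphism $\sigma$ is a *$\sigma$-pseudo field* if for some $l\ge1$ there are orthogonal idempotents $e_0,\dots,e_{l-1}$ with $L=e_0L\oplus\cdots\oplus e_{l-1}L$, $\sigma(e_i)=e_{i+1}$ (indices modulo $l$), and every $e_iL$ a field. A *Picard-Vessiot extension of $K$ for $\sigma(y)=Ay$ inside $\mathrm{Seq}_k$* is a $\sigma$-stable $K$-subalgebra $L\subset\mathrm{Seq}_k$ that is a $\sigma$-pseudo field, such that $L^\sigma=K^\sigma$ and there is $Y\in\mathrm{GL}_n(L)$ with $\sigma(Y)=AY$ for which $L$ is the total ring of fractions of $K[Y_{ij}]$. Suppose that at least one of the following (equivalent) conditions holds for $A=A(E)$: 1. for every $x=(b,B)\in X(k)$ with $b\in\mathbb N$ whose orbit is defined and every closed subvariety $V\subset X$, the set $\{i\in\mathbb N\mid\sigma^i(x)\in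 V\}$ is a finite union of arithmetic progressions; 2. there is a point $x=(b,B)\in X(k)$ with $b\in\mathbb N$ whose orbit is defined such that for every closed subvariety $V\subset X$, the set $\{i\in\mathbb N\mid\sigma^i(x)\in V\}$ is a finite union of arithmetic progressions; 3. there is a Picard-Vessiot extension of $k(z)$ for $\sigma(y)=Ay$ inside $\mathrm{Seq}_k$. Then for every solution $f\in k^{\mathbb N}$ of $E$, the set $\{i\in\mathbb N\mid f(i)=0\}$ is a finite union of arithmetic progressions. -/

import Mathlib

noncomputable section

open Filter

namespace DiffEq

/-! ### Arithmetic progressions -/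

/-- `S` is an arithmetic progression `j + ℕ l` with `j, l ∈ ℕ`. The step `l = 0` is allowed, so
that singletons are arithmetic progressions. -/
def IsArithProg (S : Set ℕ) : Prop :=
  ∃ j l : ℕ, S = {m | ∃ t : ℕ, m = j + t * l}

/-- `S` is the union of a finite set of arithmetic progressions. -/
def IsFiniteUnionArithProg (S : Set ℕ) : Prop :=
  ∃ F : Set (Set ℕ), F.Finite ∧ (∀ P ∈ F, IsArithProg P) ∧ S = ⋃₀ F

/-! ### Rational functions and the shift `z ↦ z + 1` -/

section RationalFunctions

variable {k : Type*} [Field k]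

/-- The value `h(a)` of a rational function; it is meaningful where `h` has no pole at `a`. -/
def ratVal (h : RatFunc k) (a : k) : k := h.eval (RingHom.id k) a

/-- `h` has no pole at `a`: its denominator in lowest terms does not vanish at `a`. -/
def RegularAt (h : RatFunc k) (a : k) : Prop := h.denom.eval a ≠ 0

theorem shift_aux : nonZeroDivisors (Polynomial k) ≤
    (nonZeroDivisors (Polynomial k)).comap
      (Polynomial.compRingHom (Polynomial.X + 1 : Polynomial k)) := by
  intro p hp
  rw [Submonoid.mem_comap, mem_nonZeroDivisors_iff_ne_zero]
  have hp0 := nonZeroDivisors.ne_zero hp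
  intro h
  rw [Polynomial.coe_compRingHom_apply] at h
  have h2 := congrArg (fun q : Polynomial k => q.comp (Polynomial.X - 1)) h
  simp only [Polynomial.comp_assoc, Polynomial.add_comp, Polynomial.X_comp, Polynomial.one_comp,
    sub_add_cancel, Polynomial.comp_X, Polynomial.zero_comp] at h2
  exact hp0 h2

variable (k) in
/-- The endomorphism `h(z) ↦ h(z + 1)` of `k(z)`. -/
def ratShift : RatFunc k →+* RatFunc k :=
  RatFunc.mapRingHom (Polynomial.compRingHom (Polynomial.X + 1 : Polynomial k)) shift_aux

end RationalFunctions

/-! ### The ring of sequences modulo eventual equality -/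

/-- Sequences `ℕ → k`, two sequences being identified if they agree at all large indices, with
componentwise operations. -/
def SeqRing (k : Type*) : Type _ := Germ (atTop : Filter ℕ) k

section Sequences

variable {k : Type*} [Field k]

instance : CommRing (SeqRing k) := inferInstanceAs (CommRing (Germ (atTop : Filter ℕ) k))

variable (k) in
/-- The class of a sequence, as a ring homomorphism `k^ℕ → Seq_k`. -/
def seqMk : (ℕ → k) →+* SeqRing k := Germ.coeRingHom (atTop : Filter ℕ)

theorem seqMk_eq_iff {f g : ℕ → k} : seqMk k f = seqMk k g ↔ ∀ᶠ i in atTop, f i = g i :=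
  Germ.coe_eq

theorem seqMk_surjective : Function.Surjective (seqMk k) := fun x =>
  Germ.inductionOn x fun f => ⟨f, rfl⟩

variable (k) in
/-- The shift to the left, `(f(0), f(1), …) ↦ (f(1), f(2), …)`. -/
def seqShift : SeqRing k →+* SeqRing k where
  toFun f := Germ.compTendsto (f : Germ (atTop : Filter ℕ) k) (fun i => i + 1)
    (tendsto_add_atTop_nat 1)
  map_one' := rfl
  map_zero' := rfl
  map_mul' x y := Germ.inductionOn₂ (x : Germ (atTop : Filter ℕ) k) y fun _ _ => rfl
  map_add' x y := Germ.inductionOn₂ (x : Germ (atTop : Filter ℕ) k) y fun _ _ => rfl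

theorem seqShift_seqMk (f : ℕ → k) : seqShift k (seqMk k f) = seqMk k (fun i => f (i + 1)) := rfl

variable [CharZero k]

theorem eventually_eval_ne_zero {p : Polynomial k} (hp : p ≠ 0) :
    ∀ᶠ i : ℕ in atTop, p.eval (i : k) ≠ 0 := by
  have hfin : {i : ℕ | p.eval (i : k) = 0}.Finite := by
    refine Set.Finite.of_finite_image (f := fun i : ℕ => (i : k)) ?_ Nat.cast_injective.injOn
    refine (Polynomial.finite_setOfPred_isRoot hp).subset ?_
    rintro _ ⟨i, hi, rfl⟩
    exact hi
  rw [← Nat.cofinite_eq_atTop]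
  exact hfin.compl_mem_cofinite

theorem eventually_regularAt (h : RatFunc k) : ∀ᶠ i : ℕ in atTop, RegularAt h (i : k) :=
  eventually_eval_ne_zero h.denom_ne_zero

variable (k) in
/-- The embedding `k(z) → Seq_k`, `h ↦ (h(0), h(1), h(2), …)`. -/
def ratToSeq : RatFunc k →+* SeqRing k where
  toFun h := seqMk k (fun i => ratVal h (i : k))
  map_one' := by
    rw [← map_one (seqMk k), seqMk_eq_iff]
    exact Eventually.of_forall fun i => RatFunc.eval_one _ _
  map_zero' := by
    rw [← map_zero (seqMk k), seqMk_eq_iff]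
    exact Eventually.of_forall fun i => RatFunc.eval_zero _ _
  map_mul' x y := by
    rw [← map_mul (seqMk k), seqMk_eq_iff]
    filter_upwards [eventually_regularAt x, eventually_regularAt y] with i hx hy
    exact RatFunc.eval_mul _ _ hx hy
  map_add' x y := by
    rw [← map_add (seqMk k), seqMk_eq_iff]
    filter_upwards [eventually_regularAt x, eventually_regularAt y] with i hx hy
    exact RatFunc.eval_add _ _ hx hy

instance : Algebra (RatFunc k) (SeqRing k) := (ratToSeq k).toAlgebra

theorem algebraMap_seq (h : RatFunc k) :
    algebraMap (RatFunc k) (SeqRing k) h = seqMk k (fun i => ratVal h (i : k)) := rfl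

/-- The embedding `k(z) → Seq_k` commutes with the shifts. -/
theorem seqShift_algebraMap (h : RatFunc k) :
    seqShift k (algebraMap (RatFunc k) (SeqRing k) h) =
      algebraMap (RatFunc k) (SeqRing k) (ratShift k h) := by
  have key : ∀ p : Polynomial k,
      seqShift k (algebraMap (RatFunc k) (SeqRing k) (algebraMap _ _ p)) =
        algebraMap (RatFunc k) (SeqRing k) (ratShift k (algebraMap _ _ p)) := by
    intro p
    have h1 : ratShift k (algebraMap (Polynomial k) (RatFunc k) p) =
        algebraMap (Polynomial k) (RatFunc k) (p.comp (Polynomial.X + 1)) := by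
      have := RatFunc.map_apply_div (Polynomial.compRingHom (Polynomial.X + 1 : Polynomial k))
        shift_aux p 1
      simpa [ratShift, RatFunc.coe_mapRingHom_eq_coe_map] using this
    rw [h1, algebraMap_seq, algebraMap_seq, seqShift_seqMk, seqMk_eq_iff]
    refine Eventually.of_forall fun i => ?_
    simp [ratVal, RatFunc.eval_algebraMap, Polynomial.eval₂_id, Polynomial.eval_comp]
  rw [← RatFunc.num_div_denom h, map_div₀ (ratShift k)]
  have hd : algebraMap (Polynomial k) (RatFunc k) h.denom ≠ 0 :=
    RatFunc.algebraMap_ne_zero h.denom_ne_zero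
  have hd' : ratShift k (algebraMap (Polynomial k) (RatFunc k) h.denom) ≠ 0 :=
    (map_ne_zero _).2 hd
  have hu : IsUnit (algebraMap (RatFunc k) (SeqRing k)
      (ratShift k (algebraMap (Polynomial k) (RatFunc k) h.denom))) :=
    (IsUnit.mk0 _ hd').map _
  apply hu.mul_left_injective
  simp only
  rw [← key h.denom, ← map_mul (seqShift k), ← map_mul (algebraMap (RatFunc k) (SeqRing k)),
    div_mul_cancel₀ _ hd, key h.denom, ← map_mul (algebraMap (RatFunc k) (SeqRing k)),
    div_mul_cancel₀ _ hd', key]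

end Sequences

/-! ### Picard-Vessiot extensions -/

/-- A commutative ring `L` with an endomorphism `σ` is a `σ`-pseudo field: for some `l ≥ 1` there
are orthogonal idempotents `e_0, …, e_{l-1}` with `L = e_0 L ⊕ ⋯ ⊕ e_{l-1} L`, cyclically permuted
by `σ` (the addition of `Fin (m + 1)`, where `l = m + 1`, is modulo `l`), such that every ring
`e_i L` is a field. -/
def IsPseudoField {L : Type*} [CommRing L] (σ : L →+* L) : Prop :=
  ∃ (m : ℕ) (e : Fin (m + 1) → L) (he : CompleteOrthogonalIdempotents e),
    (∀ i, σ (e i) = e (i + 1)) ∧ ∀ i, IsField (he.idem i).Corner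

/-- `L` is a Picard-Vessiot extension of the difference field `(K, σK)` for `σ(y) = A y`. -/
structure IsPicardVessiotExtension {K L : Type*} [Field K] [CommRing L] [Algebra K L]
    (σK : K →+* K) (σL : L →+* L) {n : ℕ} (A : Matrix (Fin n) (Fin n) K) : Prop where
  /-- `L` is a `K`-`σ`-algebra. -/
  compat : ∀ a : K, σL (algebraMap K L a) = algebraMap K L (σK a)
  /-- `L` is a `σ`-pseudo field. -/
  pseudoField : IsPseudoField σL
  /-- There is a fundamental solution matrix `Y` such that `L` is the total ring of fractions of
  its subring `K[Y_{ij}]`. -/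
  generated : ∃ Y : Matrix.GeneralLinearGroup (Fin n) L,
    (Y : Matrix (Fin n) (Fin n) L).map σL = A.map (algebraMap K L) * Y ∧
    IsFractionRing
      (Algebra.adjoin K {y : L | ∃ i j, y = (Y : Matrix (Fin n) (Fin n) L) i j}) L
  /-- The constants of `L` are the constants of `K`. -/
  constants : ∀ x : L, σL x = x ↔ ∃ a : K, σK a = a ∧ algebraMap K L a = x

/-- There is a Picard-Vessiot extension of `k(z)` for `σ(y) = A y` inside the ring of sequences,
that is, a `k(z)`-subalgebra `L` stable under the shift that is a Picard-Vessiot extension for the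
restriction of the shift. -/
def HasPVExtensionInSeq {k : Type*} [Field k] [CharZero k] {n : ℕ}
    (A : Matrix (Fin n) (Fin n) (RatFunc k)) : Prop :=
  ∃ (L : Subalgebra (RatFunc k) (SeqRing k)) (hL : ∀ x ∈ L, seqShift k x ∈ L),
    IsPicardVessiotExtension (K := RatFunc k) (L := L) (ratShift k)
      ((seqShift k).restrict L L hL) A

/-! ### The rational self-map `(b, B) ↦ (b + 1, A(b) B)` of `𝔸¹ × GL_n` -/

section Dynamics

variable {k : Type*} [Field k] {n : ℕ}

/-- The set `X(k)` of `k`-points of `X = 𝔸¹ × GL_n`. -/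
abbrev Pt (k : Type*) [Field k] (n : ℕ) : Type _ := k × Matrix.GeneralLinearGroup (Fin n) k

/-- The matrix `A(b)`. -/
def matVal (A : Matrix (Fin n) (Fin n) (RatFunc k)) (b : k) : Matrix (Fin n) (Fin n) k :=
  A.map fun h => ratVal h b

/-- The (`k`-points of the) largest open subset of `X` on which the rational map
`(b, B) ↦ (b + 1, A(b) B)` from `X` to `X` is defined. As `B` is invertible, `A(z) Z` is regular at
`(b, B)` if and only if all entries of `A` are regular at `b`, and then the image lies in `X` if and
only if `A(b)` is invertible. -/
def ratMapDomain (A : Matrix (Fin n) (Fin n) (RatFunc k)) : Set (Pt k n) :=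
  {x | (∀ i j, RegularAt (A i j) x.1) ∧ (matVal A x.1).det ≠ 0}

open Classical in
/-- The map `(b, B) ↦ (b + 1, A(b) B)` on `k`-points. Outside its domain of definition it is
given the irrelevant value `x`. -/
def ratMap (A : Matrix (Fin n) (Fin n) (RatFunc k)) (x : Pt k n) : Pt k n :=
  if h : x ∈ ratMapDomain A then
    (x.1 + 1, Matrix.GeneralLinearGroup.mkOfDetNeZero (matVal A x.1) h.2 * x.2)
  else x

/-- The orbit of `x` is defined: `x ∈ U, σ(x) ∈ U, σ²(x) ∈ U, …`, where `U` is the domain. -/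
def OrbitDefined (A : Matrix (Fin n) (Fin n) (RatFunc k)) (x : Pt k n) : Prop :=
  ∀ i : ℕ, (ratMap A)^[i] x ∈ ratMapDomain A

/-- The coordinates `z`, `Z_{ij}` of a point of `X`. -/
def coords (x : Pt k n) : Option (Fin n × Fin n) → k
  | none => x.1
  | some ij => (x.2 : Matrix (Fin n) (Fin n) k) ij.1 ij.2

/-- `Y` is the set of `k`-points of a closed subvariety of `X`, not necessarily irreducible. As
`det Z` is invertible on `X`, closed subvarieties are cut out by elements of `k[z, Z_{ij}]`. -/
def IsClosedSubvariety (Y : Set (Pt k n)) : Prop :=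
  ∃ S : Set (MvPolynomial (Option (Fin n × Fin n)) k),
    Y = {x | ∀ p ∈ S, MvPolynomial.eval (coords x) p = 0}

/-- For every closed subvariety `Y` of `X`, the set of `i ∈ ℕ` with `σ^i(x) ∈ Y` is a finite union
of arithmetic progressions. -/
def ReturnSetsAreArithmetic (A : Matrix (Fin n) (Fin n) (RatFunc k)) (x : Pt k n) : Prop :=
  ∀ Y : Set (Pt k n), IsClosedSubvariety Y →
    IsFiniteUnionArithProg {i : ℕ | (ratMap A)^[i] x ∈ Y}

/-- Dynamical Mordell-Lang for every point `(b, B)` with `b ∈ ℕ` whose orbit is defined. -/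
def DMLForAllPoints (A : Matrix (Fin n) (Fin n) (RatFunc k)) : Prop :=
  ∀ (b : ℕ) (B : Matrix.GeneralLinearGroup (Fin n) k),
    OrbitDefined A ((b : k), B) → ReturnSetsAreArithmetic A ((b : k), B)

/-- Dynamical Mordell-Lang for some point `(b, B)` with `b ∈ ℕ` whose orbit is defined. -/
def DMLForSomePoint (A : Matrix (Fin n) (Fin n) (RatFunc k)) : Prop :=
  ∃ (b : ℕ) (B : Matrix.GeneralLinearGroup (Fin n) k),
    OrbitDefined A ((b : k), B) ∧ ReturnSetsAreArithmetic A ((b : k), B)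

end Dynamics

/-! ### Scalar linear difference equations -/

section Equation

variable {k : Type*} [Field k] {n : ℕ}

/-- The companion matrix `A(E)` of `E = σ^n(y) + h_{n-1} σ^{n-1}(y) + ⋯ + h_0 y`: ones on the
superdiagonal and last row `(-h_0, …, -h_{n-1})`. -/
def companion (h : Fin n → RatFunc k) : Matrix (Fin n) (Fin n) (RatFunc k) :=
  Matrix.of fun i j =>
    if (i : ℕ) + 1 = n then -h j else if (j : ℕ) = (i : ℕ) + 1 then 1 else 0

/-- `f : ℕ → k` is a solution of `E`:
`f(i+n) + h_{n-1}(i) f(i+n-1) + ⋯ + h_0(i) f(i) = 0` for all sufficiently large `i`. -/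
def IsSolution (h : Fin n → RatFunc k) (f : ℕ → k) : Prop :=
  ∀ᶠ i : ℕ in atTop, f (i + n) + ∑ j : Fin n, ratVal (h j) (i : k) * f (i + (j : ℕ)) = 0

end Equation

end DiffEq

end

/-! The finite unions of arithmetic progressions are exactly the eventually periodic subsets of ℕ
(`isFiniteUnionArithProg_iff`), so finitely many indices and a translation of the index do not
matter. Condition 1 implies condition 2, because a starting point `b` beyond all poles of `A` and
all poles and zeros of `h 0` has a defined orbit. Under condition 2, the matrix parts of the orbit
form a fundamental matrix, so for large `i` the vector `(f(i+b), …, f(i+b+n-1))` is the orbit matrix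
times a fixed vector `c` (`OrbitDefined.exists_mulVec_eq`). Thus `f(i+b) = 0` says that the orbit
lies on the closed subvariety given by one linear equation in the first row of `Z`. Under condition
3, the shift-invariant elements of `Seq_k` are the constants `k`, so the Picard-Vessiot ring `L`
contains every solution in `Seq_k` (`mem_of_fundamental_matrix`). The idempotents of `L` are
eventually periodic sequences, and in the field `e_j L` the element `e_j f` is zero or invertible.
On the support of `e_j`, then, `f` eventually vanishes everywhere or nowhere. -/

namespace DiffEq

open Filter

/-! ### Finite unions of arithmetic progressions and eventual periodicity -/

/-- `S` is eventually periodic with period `l`. -/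
def IsEventuallyPeriodic (l : ℕ) (S : Set ℕ) : Prop :=
  ∀ᶠ i : ℕ in atTop, i + l ∈ S ↔ i ∈ S

theorem IsEventuallyPeriodic.mul_left {l : ℕ} {S : Set ℕ} (hS : IsEventuallyPeriodic l S)
    (c : ℕ) : IsEventuallyPeriodic (c * l) S := by
  induction c with
  | zero => exact Eventually.of_forall fun i => by simp
  | succ c ih =>
    have h2 := (tendsto_add_atTop_nat (c * l)).eventually hS
    filter_upwards [ih, h2] with i h1 h2
    rw [Nat.succ_mul, ← add_assoc, h2, h1]

theorem IsArithProg.exists_eventually_periodic {S : Set ℕ} (hS : IsArithProg S) :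
    ∃ l, 0 < l ∧ IsEventuallyPeriodic l S := by
  obtain ⟨j, l, rfl⟩ := hS
  rcases Nat.eq_zero_or_pos l with rfl | hl
  · refine ⟨1, one_pos, ?_⟩
    filter_upwards [eventually_gt_atTop j] with i hi
    simp only [mul_zero, add_zero, exists_const]
    omega
  · refine ⟨l, hl, ?_⟩
    filter_upwards [eventually_ge_atTop j] with i hi
    constructor
    · rintro ⟨t, ht⟩
      rcases t with _ | t
      · omega
      · exact ⟨t, by rw [Nat.succ_mul] at ht; omega⟩
    · rintro ⟨t, ht⟩
      exact ⟨t + 1, by rw [Nat.succ_mul]; omega⟩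

/-- Induction on `F`: the product of two periods is a common period. -/
theorem exists_eventually_periodic_sUnion {F : Set (Set ℕ)} (hF : F.Finite)
    (h : ∀ P ∈ F, ∃ l, 0 < l ∧ IsEventuallyPeriodic l P) :
    ∃ l, 0 < l ∧ IsEventuallyPeriodic l (⋃₀ F) := by
  induction F, hF using Set.Finite.induction_on with
  | empty => exact ⟨1, one_pos, Eventually.of_forall fun i => by simp⟩
  | @insert P F _ _ ih =>
    obtain ⟨l, hl, h1⟩ := ih fun Q hQ => h Q (Set.mem_insert_of_mem _ hQ)
    obtain ⟨m, hm, h2⟩ := h P (Set.mem_insert _ _)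
    refine ⟨m * l, Nat.mul_pos hm hl, ?_⟩
    have h3 := h2.mul_left l
    rw [mul_comm] at h3
    filter_upwards [h1.mul_left m, h3] with i h4 h5
    rw [Set.sUnion_insert, Set.mem_union, Set.mem_union, h4, h5]

/-- The finite unions of arithmetic progressions are the eventually periodic sets. -/
theorem isFiniteUnionArithProg_iff {S : Set ℕ} :
    IsFiniteUnionArithProg S ↔ ∃ l, 0 < l ∧ IsEventuallyPeriodic l S := by
  constructor
  · rintro ⟨F, hF, hP, rfl⟩
    exact exists_eventually_periodic_sUnion hF fun P h => (hP P h).exists_eventually_periodic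
  · rintro ⟨l, hl, hS⟩
    obtain ⟨N, hN⟩ := eventually_atTop.1 hS
    have hper : ∀ t i, N ≤ i → (i + t * l ∈ S ↔ i ∈ S) := by
      intro t
      induction t with
      | zero => simp
      | succ t ih =>
        intro i hi
        rw [Nat.succ_mul, ← add_assoc, hN _ (le_trans hi (Nat.le_add_right _ _)), ih i hi]
    -- Singletons below the threshold `N`, and above it one progression for each element of `S` in
    -- the window `[N, N + l)`.
    refine ⟨(fun j => {m | ∃ t : ℕ, m = j + t * 0}) '' {j | j < N ∧ j ∈ S} ∪
      (fun j => {m | ∃ t : ℕ, m = j + t * l}) '' {j | (N ≤ j ∧ j < N + l) ∧ j ∈ S}, ?_, ?_, ?_⟩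
    · refine (Set.Finite.image _ ((Set.finite_lt_nat N).subset fun j h => h.1)).union
        (Set.Finite.image _ ((Set.finite_lt_nat (N + l)).subset fun j h => h.1.2))
    · rintro P (⟨j, -, rfl⟩ | ⟨j, -, rfl⟩)
      · exact ⟨j, 0, rfl⟩
      · exact ⟨j, l, rfl⟩
    · ext i
      constructor
      · intro hi
        rcases lt_or_ge i N with h | h
        · exact ⟨_, Or.inl ⟨i, ⟨h, hi⟩, rfl⟩, 0, by simp⟩
        · have hdm := Nat.mod_add_div (i - N) l
          have hlt := Nat.mod_lt (i - N) hl
          have heq : i = N + (i - N) % l + (i - N) / l * l := by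
            rw [mul_comm ((i - N) / l)]; omega
          refine ⟨_, Or.inr ⟨N + (i - N) % l, ⟨⟨by omega, by omega⟩, ?_⟩, rfl⟩, _, heq⟩
          rwa [← hper ((i - N) / l) _ (by omega), ← heq]
      · rintro ⟨P, ⟨j, ⟨-, hj⟩, rfl⟩ | ⟨j, ⟨⟨h1, -⟩, hj⟩, rfl⟩, t, rfl⟩
        · simpa using hj
        · exact (hper t j h1).2 hj

/-! ### Solutions and the companion matrix -/

section Companion

variable {k : Type*} [Field k] {n : ℕ}

theorem denom_neg_dvd (g : RatFunc k) : (-g).denom ∣ g.denom :=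
  (RatFunc.denom_dvd g.denom_ne_zero).2
    ⟨-g.num, by rw [map_neg, neg_div, RatFunc.num_div_denom]⟩

theorem denom_neg (g : RatFunc k) : (-g).denom = g.denom := by
  refine Polynomial.eq_of_monic_of_associated (RatFunc.monic_denom _) (RatFunc.monic_denom _)
    (associated_of_dvd_dvd (denom_neg_dvd g) ?_)
  simpa using denom_neg_dvd (-g)

/-- Valid at poles too: `g` and `-g` have the same denominator and opposite numerators, and division
by zero gives `0` on both sides. -/
theorem ratVal_neg (g : RatFunc k) (a : k) : ratVal (-g) a = -ratVal g a := by
  have hnum : (-g).num = -g.num := by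
    have := RatFunc.num_denom_neg g
    rw [denom_neg] at this
    exact mul_right_cancel₀ g.denom_ne_zero this
  simp [ratVal, RatFunc.eval, denom_neg, hnum, neg_div]

theorem matVal_companion_mulVec [NeZero n] (h : Fin n → RatFunc k) (a : k) (v : Fin n → k)
    (i : Fin n) : (matVal (companion h) a).mulVec v i =
      if hi : (i : ℕ) + 1 < n then v ⟨i + 1, hi⟩ else -∑ j, ratVal (h j) a * v j := by
  rw [Matrix.mulVec, dotProduct]
  split_ifs with hi
  · rw [Finset.sum_eq_single ⟨(i : ℕ) + 1, hi⟩]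
    · simp [matVal, companion, hi.ne, ratVal, RatFunc.eval_one]
    · intro j _ hj
      have : (j : ℕ) ≠ (i : ℕ) + 1 := fun hh => hj (Fin.ext hh)
      simp [matVal, companion, hi.ne, this, ratVal, RatFunc.eval_zero]
    · simp
  · have : (i : ℕ) + 1 = n := by omega
    rw [← Finset.sum_neg_distrib]
    refine Finset.sum_congr rfl fun j _ => ?_
    simp [matVal, companion, this, ratVal_neg]

/-- For a kernel vector, the superdiagonal rows kill all coordinates but the first, and the last row
then kills that one because `h_0(a) ≠ 0`. -/
theorem det_matVal_companion_ne_zero [NeZero n] {h : Fin n → RatFunc k} {a : k}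
    (ha : ratVal (h 0) a ≠ 0) : (matVal (companion h) a).det ≠ 0 := by
  rw [Ne, ← Matrix.exists_mulVec_eq_zero_iff]
  rintro ⟨v, hv, h0⟩
  have hn := Nat.pos_of_ne_zero (NeZero.ne n)
  have hs : ∀ j : Fin n, j ≠ 0 → v j = 0 := by
    intro j hj
    have hj' : (j : ℕ) ≠ 0 := fun hh => hj (Fin.ext (by simpa using hh))
    have := congrFun h0 ⟨j - 1, by omega⟩
    rw [matVal_companion_mulVec, dif_pos (show (j : ℕ) - 1 + 1 < n by omega)] at this
    exact (congrArg v (Fin.ext (show (j : ℕ) = j - 1 + 1 by omega))).trans this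
  refine hv (funext fun j => ?_)
  by_cases hj : j = 0
  · have := congrFun h0 ⟨n - 1, by omega⟩
    rw [matVal_companion_mulVec, dif_neg (show ¬((n - 1 : ℕ) + 1 < n) by omega),
      Finset.sum_eq_single 0 (fun i _ hi => by rw [hs i hi, mul_zero]) (by simp)] at this
    have h1 : ratVal (h 0) a * v 0 = 0 := by simpa using this
    rw [hj]
    exact (mul_eq_zero.1 h1).resolve_left ha
  · exact hs j hj

/-- The vector `(f(i), …, f(i + n - 1))`. -/
def window (n : ℕ) (f : ℕ → k) (i : ℕ) : Fin n → k := fun j => f (i + j)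

theorem IsSolution.window_succ [NeZero n] {h : Fin n → RatFunc k} {f : ℕ → k}
    (hf : IsSolution h f) : ∀ᶠ i : ℕ in atTop,
      window n f (i + 1) = (matVal (companion h) (i : k)).mulVec (window n f i) := by
  filter_upwards [hf] with i hi
  funext j
  rw [matVal_companion_mulVec]
  split_ifs with hj
  · exact congrArg f (show i + 1 + (j : ℕ) = i + (j + 1) by omega)
  · exact (congrArg f (show i + 1 + (j : ℕ) = i + n by omega)).trans
      (eq_neg_iff_add_eq_zero.2 hi)

theorem eventually_ratVal_ne_zero [CharZero k] {g : RatFunc k} (hg : g ≠ 0) :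
    ∀ᶠ i : ℕ in atTop, ratVal g (i : k) ≠ 0 := by
  filter_upwards [eventually_regularAt g,
    eventually_eval_ne_zero (RatFunc.num_ne_zero hg)] with i h1 h2
  exact div_ne_zero h2 h1

end Companion

/-! ### Orbits -/

section Orbits

variable {k : Type*} [Field k] {n : ℕ} {A : Matrix (Fin n) (Fin n) (RatFunc k)} {x : Pt k n}

theorem OrbitDefined.iterate_fst (hx : OrbitDefined A x) (i : ℕ) :
    ((ratMap A)^[i] x).1 = x.1 + i := by
  induction i with
  | zero => simp
  | succ i ih =>
    rw [Function.iterate_succ_apply', ratMap, dif_pos (hx i)]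
    simp only [ih]
    push_cast
    ring

theorem OrbitDefined.iterate_succ_snd (hx : OrbitDefined A x) (i : ℕ) :
    (((ratMap A)^[i + 1] x).2 : Matrix (Fin n) (Fin n) k) =
      matVal A (x.1 + i) * ((ratMap A)^[i] x).2 := by
  rw [Function.iterate_succ_apply', ratMap, dif_pos (hx i), ← hx.iterate_fst i]
  rfl

/-- If the matrices `A(b), A(b + 1), …` are regular and invertible, then the orbit of `(b, B)` is
defined. -/
theorem orbitDefined_of_forall (h : ∀ i : ℕ, (∀ r s, RegularAt (A r s) (x.1 + i)) ∧
    (matVal A (x.1 + i)).det ≠ 0) : OrbitDefined A x := by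
  have key : ∀ i : ℕ, ((ratMap A)^[i] x).1 = x.1 + i := by
    intro i
    induction i with
    | zero => simp
    | succ i ih =>
      have hm : (ratMap A)^[i] x ∈ ratMapDomain A := by
        rw [ratMapDomain, Set.mem_ofPred_eq, ih]
        exact h i
      rw [Function.iterate_succ_apply', ratMap, dif_pos hm]
      simp only [ih]
      push_cast
      ring
  intro i
  rw [ratMapDomain, Set.mem_ofPred_eq, key]
  exact h i

/-- The condition on all points is not void. -/
theorem DMLForAllPoints.forSomePoint [CharZero k] [NeZero n] {h : Fin n → RatFunc k}
    (h0 : h 0 ≠ 0) (hA : DMLForAllPoints (companion h)) : DMLForSomePoint (companion h) := by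
  have h1 : ∀ᶠ i : ℕ in atTop, ∀ r s, RegularAt (companion h r s) (i : k) :=
    eventually_all.2 fun r => eventually_all.2 fun s => eventually_regularAt _
  obtain ⟨b, hb⟩ := eventually_atTop.1 (h1.and (eventually_ratVal_ne_zero h0))
  have hdef : OrbitDefined (companion h) ((b : k), 1) := by
    refine orbitDefined_of_forall fun i => ?_
    have := hb (b + i) (Nat.le_add_right _ _)
    rw [Nat.cast_add] at this
    exact ⟨this.1, det_matVal_companion_ne_zero this.2⟩
  exact ⟨b, 1, hdef, hA b 1 hdef⟩

/-- Along a defined orbit, every sequence of vectors with `v(i + 1) = A(i) v(i)` is eventually a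
fixed linear combination of the columns. -/
theorem OrbitDefined.exists_mulVec_eq {b : ℕ} {B : Matrix.GeneralLinearGroup (Fin n) k}
    (hx : OrbitDefined A ((b : k), B)) {v : ℕ → Fin n → k}
    (hv : ∀ᶠ i : ℕ in atTop, v (i + 1) = (matVal A (i : k)).mulVec (v i)) :
    ∃ c : Fin n → k, ∀ᶠ i : ℕ in atTop, v (i + b) =
      (((ratMap A)^[i] ((b : k), B)).2 : Matrix (Fin n) (Fin n) k).mulVec c := by
  obtain ⟨N, hN⟩ := eventually_atTop.1 hv
  set D : ℕ → Matrix.GeneralLinearGroup (Fin n) k :=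
    fun i => ((ratMap A)^[i] ((b : k), B)).2 with hD
  -- The vector `c` is forced by the equation at `i = N`; both sides then obey the same recursion.
  refine ⟨((D N)⁻¹ : Matrix.GeneralLinearGroup (Fin n) k).1.mulVec (v (N + b)),
    eventually_atTop.2 ⟨N, fun i hi => ?_⟩⟩
  induction i, hi using Nat.le_induction with
  | base =>
    change _ = (D N).1.mulVec _
    rw [Matrix.mulVec_mulVec, ← Units.val_mul, mul_inv_cancel, Units.val_one, Matrix.one_mulVec]
  | succ i hi ih =>
    rw [hx.iterate_succ_snd, ← Matrix.mulVec_mulVec, ← ih, add_right_comm,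
      hN (i + b) (by omega)]
    congr 2
    push_cast
    ring

theorem isFiniteUnionArithProg_zeros_of_point [NeZero n] {h : Fin n → RatFunc k}
    (hA : DMLForSomePoint (companion h)) {f : ℕ → k} (hf : IsSolution h f) :
    IsFiniteUnionArithProg {i : ℕ | f i = 0} := by
  obtain ⟨b, B, hx, hret⟩ := hA
  obtain ⟨c, hc⟩ := hx.exists_mulVec_eq hf.window_succ
  -- At a point `(b, B)` this is the first coordinate of `B c`.
  let p : MvPolynomial (Option (Fin n × Fin n)) k :=
    ∑ j, MvPolynomial.X (some (0, j)) * MvPolynomial.C (c j)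
  have hV : IsClosedSubvariety {y : Pt k n | ∀ q ∈ ({p} : Set _),
    MvPolynomial.eval (coords y) q = 0} := ⟨{p}, rfl⟩
  obtain ⟨l, hl, hper⟩ := isFiniteUnionArithProg_iff.1 (hret _ hV)
  have hmem : ∀ᶠ i : ℕ in atTop, f (i + b) = 0 ↔ i ∈ {i : ℕ | (ratMap (companion h))^[i]
      ((b : k), B) ∈ {y : Pt k n | ∀ q ∈ ({p} : Set _),
        MvPolynomial.eval (coords y) q = 0}} := by
    filter_upwards [hc] with i hi
    have h1 : f (i + b) = window n f (i + b) 0 := by simp [window]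
    rw [h1, hi]
    simp [p, coords, Matrix.mulVec, dotProduct]
  refine isFiniteUnionArithProg_iff.2 ⟨l, hl, ?_⟩
  have hshift := (hper.and (hmem.and ((tendsto_add_atTop_nat l).eventually hmem)))
  obtain ⟨N, hN⟩ := eventually_atTop.1 hshift
  refine eventually_atTop.2 ⟨N + b, fun i hi => ?_⟩
  obtain ⟨h1, h2, h3⟩ := hN (i - b) (by omega)
  rw [← h2, ← h3, show i - b + l + b = i + l by omega, show i - b + b = i by omega] at h1
  exact h1

end Orbits

/-! ### Pseudo fields inside the ring of sequences -/

section PicardVessiot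

variable {k : Type*} [Field k]

theorem exists_const_of_seqShift_eq {x : SeqRing k} (hx : seqShift k x = x) :
    ∃ a : k, x = seqMk k fun _ => a := by
  obtain ⟨g, rfl⟩ := seqMk_surjective x
  rw [seqShift_seqMk, seqMk_eq_iff] at hx
  obtain ⟨N, hN⟩ := eventually_atTop.1 hx
  refine ⟨g N, seqMk_eq_iff.2 (eventually_atTop.2 ⟨N, fun i hi => ?_⟩)⟩
  induction i, hi using Nat.le_induction with
  | base => rfl
  | succ i hi ih => rw [hN i hi, ih]

variable [CharZero k]

theorem algebraMap_C_seq (a : k) :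
    algebraMap (RatFunc k) (SeqRing k) (RatFunc.C a) = seqMk k fun _ => a := by
  rw [algebraMap_seq]
  simp [ratVal, RatFunc.eval_C]

/-- Every solution of `σ(y) = A y` in sequences has its entries in each subring that contains a
fundamental matrix and the constants. -/
theorem mem_of_fundamental_matrix {n : ℕ} {A : Matrix (Fin n) (Fin n) (RatFunc k)}
    {L : Subalgebra (RatFunc k) (SeqRing k)} {Y : Matrix.GeneralLinearGroup (Fin n) (SeqRing k)}
    (hY : (Y : Matrix (Fin n) (Fin n) (SeqRing k)).map (seqShift k) =
      A.map (algebraMap (RatFunc k) (SeqRing k)) * Y)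
    (hYL : ∀ i j, (Y : Matrix (Fin n) (Fin n) (SeqRing k)) i j ∈ L) {v : Fin n → SeqRing k}
    (hv : (fun i => seqShift k (v i)) = (A.map (algebraMap _ _)).mulVec v) (i : Fin n) :
    v i ∈ L := by
  set c : Fin n → SeqRing k :=
    ((Y⁻¹ : Matrix.GeneralLinearGroup (Fin n) (SeqRing k)) : Matrix _ _ _).mulVec v with hc
  have hvc : v = (Y : Matrix (Fin n) (Fin n) (SeqRing k)).mulVec c := by
    rw [hc, Matrix.mulVec_mulVec, ← Units.val_mul, mul_inv_cancel, Units.val_one,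
      Matrix.one_mulVec]
  have hσ : (fun j => seqShift k (c j)) = c := by
    -- `σ(Y) σ(c) = σ(v) = A v = A Y c = σ(Y) c`, and `σ(Y)` is invertible.
    have h1 : ((Y : Matrix (Fin n) (Fin n) (SeqRing k)).map (seqShift k)).mulVec
        (fun j => seqShift k (c j)) =
        ((Y : Matrix (Fin n) (Fin n) (SeqRing k)).map (seqShift k)).mulVec c := by
      conv_rhs => rw [hY, ← Matrix.mulVec_mulVec, ← hvc, ← hv, hvc]
      funext r
      exact (RingHom.map_mulVec (seqShift k) _ c r).symm
    have hu : IsUnit ((Y : Matrix (Fin n) (Fin n) (SeqRing k)).map (seqShift k)) :=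
      Y.isUnit.map (seqShift k).mapMatrix
    exact Matrix.mulVec_injective_of_isUnit hu h1
  rw [hvc, Matrix.mulVec, dotProduct]
  refine Subalgebra.sum_mem _ fun j _ => L.mul_mem (hYL i j) ?_
  obtain ⟨a, ha⟩ := exists_const_of_seqShift_eq (congrFun hσ j)
  rw [ha, ← algebraMap_C_seq]
  exact L.algebraMap_mem _

/-- The zero set of a sequence in a pseudo field inside `Seq_k` is eventually periodic. -/
theorem isFiniteUnionArithProg_zeros_of_pseudoField {L : Subalgebra (RatFunc k) (SeqRing k)}
    {hL : ∀ x ∈ L, seqShift k x ∈ L} (hps : IsPseudoField ((seqShift k).restrict L L hL))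
    {f : ℕ → k} (hf : seqMk k f ∈ L) : IsFiniteUnionArithProg {i : ℕ | f i = 0} := by
  obtain ⟨m, e, he, hσ, hfield⟩ := hps
  choose E hE using fun i => seqMk_surjective (e i : SeqRing k)
  have hshift : ∀ j, ∀ᶠ i : ℕ in atTop, E j (i + 1) = E (j + 1) i := by
    intro j
    rw [← seqMk_eq_iff, ← seqShift_seqMk, hE, hE, ← hσ j]
    rfl
  have hsum : ∀ᶠ i : ℕ in atTop, ∑ j, E j i = 1 := by
    have h1 : seqMk k (∑ j, E j) = seqMk k 1 := by
      rw [map_sum, map_one]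
      simp only [hE]
      have := congrArg (Subtype.val : L → SeqRing k) he.complete
      rw [AddSubmonoidClass.coe_finsetSum] at this
      exact this
    filter_upwards [seqMk_eq_iff.1 h1] with i hi
    simpa using hi
  -- Each shift moves `e j` to `e (j + 1)`, and `m + 1` shifts return to `e j`.
  have hper : ∀ᶠ i : ℕ in atTop, ∀ j, E j (i + (m + 1)) = E j i := by
    rw [eventually_all]
    intro j
    have key : ∀ t : ℕ, ∀ᶠ i : ℕ in atTop, E j (i + t) = E (j + t • 1) i := by
      intro t
      induction t with
      | zero => simp
      | succ t ih =>
        filter_upwards [(tendsto_add_atTop_nat 1).eventually ih,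
          hshift (j + t • 1)] with i h1 h2
        rw [show i + (t + 1) = i + 1 + t by omega, h1, h2, succ_nsmul, add_assoc]
    have := key (m + 1)
    rwa [show (m + 1) • (1 : Fin (m + 1)) = 0 by
      simpa using card_nsmul_eq_zero (x := (1 : Fin (m + 1))), add_zero] at this
  -- on the support of each idempotent the sequence vanishes eventually or nowhere eventually
  have hdich : ∀ j, (∀ᶠ i : ℕ in atTop, E j i ≠ 0 → f i = 0) ∨
      (∀ᶠ i : ℕ in atTop, E j i ≠ 0 → f i ≠ 0) := by
    intro j
    by_cases h0 : e j * ⟨seqMk k f, hf⟩ = 0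
    · left
      have h1 : seqMk k (E j * f) = seqMk k 0 := by
        rw [map_mul, hE, map_zero]
        exact congrArg (Subtype.val : L → SeqRing k) h0
      filter_upwards [seqMk_eq_iff.1 h1] with i hi hne
      exact (mul_eq_zero.1 hi).resolve_left hne
    · right
      let y : (he.idem j).Corner := ⟨e j * ⟨seqMk k f, hf⟩, by
        rw [Subsemigroup.mem_corner_iff (he.idem j)]
        constructor
        · rw [← mul_assoc, (he.idem j).eq]
        · rw [mul_comm, ← mul_assoc, (he.idem j).eq]⟩
      have hy : y ≠ 0 := fun h => h0 (congrArg Subtype.val h)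
      obtain ⟨w, hw⟩ := (hfield j).mul_inv_cancel hy
      -- The identity of the corner field is `e j`, so where `E j` is nonzero the product `E j * f *
      -- g` is eventually nonzero, and so is `f`.
      have hw' : e j * ⟨seqMk k f, hf⟩ * w.1 = e j := congrArg Subtype.val hw
      obtain ⟨g, hg⟩ := seqMk_surjective (w.1 : SeqRing k)
      have h1 : seqMk k (E j * f * g) = seqMk k (E j) := by
        rw [map_mul, map_mul, hE, hg]
        exact congrArg (Subtype.val : L → SeqRing k) hw'
      filter_upwards [seqMk_eq_iff.1 h1] with i hi hne hfi
      simp only [Pi.mul_apply, hfi, mul_zero, zero_mul] at hi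
      exact hne hi.symm
  -- On the support of `E j`, whether `f i = 0` is decided by one proposition independent of `i`.
  have hconst : ∀ᶠ i : ℕ in atTop, ∀ j, E j i ≠ 0 →
      (f i = 0 ↔ ∀ᶠ i : ℕ in atTop, E j i ≠ 0 → f i = 0) := by
    rw [eventually_all]
    intro j
    by_cases hj : ∀ᶠ i : ℕ in atTop, E j i ≠ 0 → f i = 0
    · filter_upwards [hj] with i hi hne
      simp only [hi hne, hj]
    · filter_upwards [(hdich j).resolve_left hj] with i hi hne
      simp only [hi hne, hj]
  refine isFiniteUnionArithProg_iff.2 ⟨m + 1, Nat.succ_pos m, ?_⟩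
  filter_upwards [hsum, hper, hconst, (tendsto_add_atTop_nat (m + 1)).eventually hconst]
    with i h1 h2 h3 h4
  -- As the idempotents sum to `1`, some `E j` is nonzero at `i`; by periodicity the same one is
  -- nonzero at `i + (m + 1)`, so both indices get the same verdict.
  obtain ⟨j, -, hj⟩ := Finset.exists_ne_zero_of_sum_ne_zero (h1.trans_ne one_ne_zero)
  have hj' : E j (i + (m + 1)) ≠ 0 := by rwa [h2 j]
  exact (h4 j hj').trans (h3 j hj).symm

theorem IsSolution.seqShift_eq {n : ℕ} [NeZero n] {h : Fin n → RatFunc k} {f : ℕ → k}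
    (hf : IsSolution h f) :
    (fun j : Fin n => seqShift k (seqMk k fun i => f (i + j))) =
      ((companion h).map (algebraMap (RatFunc k) (SeqRing k))).mulVec
        fun j : Fin n => seqMk k fun i => f (i + j) := by
  funext r
  have h1 : ((companion h).map (algebraMap (RatFunc k) (SeqRing k))).mulVec
      (fun j : Fin n => seqMk k fun i => f (i + j)) r =
      seqMk k (∑ s, (fun i : ℕ => ratVal (companion h r s) (i : k)) * fun i => f (i + s)) := by
    rw [map_sum, Matrix.mulVec, dotProduct]
    refine Finset.sum_congr rfl fun s _ => ?_
    rw [map_mul, Matrix.map_apply, algebraMap_seq]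
  rw [h1, seqShift_seqMk, seqMk_eq_iff]
  filter_upwards [hf.window_succ] with i hi
  simpa [window, Matrix.mulVec, dotProduct, matVal] using congrFun hi r

theorem isFiniteUnionArithProg_zeros_of_PV {n : ℕ} [NeZero n] {h : Fin n → RatFunc k}
    (hA : HasPVExtensionInSeq (companion h)) {f : ℕ → k} (hf : IsSolution h f) :
    IsFiniteUnionArithProg {i : ℕ | f i = 0} := by
  obtain ⟨L, hL, hPV⟩ := hA
  obtain ⟨Y, hY, -⟩ := hPV.generated
  have hmem := mem_of_fundamental_matrix (A := companion h) (L := L)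
    (Y := Matrix.GeneralLinearGroup.map (L.val : L →+* SeqRing k) Y) (by
      ext i j
      have := congrArg (Subtype.val : L → SeqRing k) (congrFun (congrFun hY i) j)
      refine this.trans ?_
      simp only [Matrix.mul_apply, AddSubmonoidClass.coe_finsetSum]
      rfl) (fun i j => ((Y : Matrix (Fin n) (Fin n) L) i j).2) hf.seqShift_eq 0
  exact isFiniteUnionArithProg_zeros_of_pseudoField hPV.pseudoField (by simpa using hmem)

end PicardVessiot

end DiffEq

theorem mainTheorem6 {k : Type*} [Field k] [CharZero k] (n : ℕ) [NeZero n]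
    (h : Fin n → RatFunc k) (h0 : h 0 ≠ 0)
    (hcond : DiffEq.DMLForAllPoints (DiffEq.companion h) ∨
      DiffEq.DMLForSomePoint (DiffEq.companion h) ∨
      DiffEq.HasPVExtensionInSeq (DiffEq.companion h))
    (f : ℕ → k) (hf : DiffEq.IsSolution h f) :
    DiffEq.IsFiniteUnionArithProg {i : ℕ | f i = 0} := by
  rcases hcond with hA | hA | hA
  · exact DiffEq.isFiniteUnionArithProg_zeros_of_point (hA.forSomePoint h0) hf
  · exact DiffEq.isFiniteUnionArithProg_zeros_of_point hA hf
  · exact DiffEq.isFiniteUnionArithProg_zeros_of_PV hA hf
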